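/- Let $\gamma$ be the standard Gaussian measure on $\mathbb R$ and let $H_q$ be the $q$-th probabilists' Hermite polynomial, $H_q(x)=(-1)^q e^{x^2/2}\frac{d^q}{dx^q}e^{-x^2/2}$. For an integer $k\ge 0$ and a real $p\ge 1$ let $\mathbb D^{k,p}(\mathbb R,\gamma)$ be the space of functions in $L^p(\mathbb R,\gamma)$ that are $k$ times weakly differentiable with weak derivatives of orders $1,\dots,k$ in $L^p(\mathbb R,\gamma)$. For $g\in L^2(\mathbb R,\gamma)$ with Hermite coefficients $c_q=\frac1{q!}\int_{\mathbb R} g\,H_q\,d\gamma$, so that $g=\sum_{q\ge0}c_qH_q$ in $L^2(\mathbb R,\gamma)$, let $A(g)=\sum_{q\ge 0}|c_q|H_q$, where the series converges in $L^2(\mathbb R,\gamma)$. Lemma 3.3. Fix integers $\ell\ge 0$ and $M\ge 3$, and let $g\in\mathbb D^{\ell,2}(\mathbb R,\gamma)$ have Hermite coefficients $c_q$, $q\ge 0$. If $$\sum_{q=1}^{\infty}|c_q|\,q^{\frac{\ell}{2}-\frac14}\,\sqrt{q!}\,(M-1)^{\frac q2}<\infty,$$ then $A(g)\in\mathbb D^{\ell,M}(\mathbb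 R,\gamma)$. -/

import Mathlib

open MeasureTheory ProbabilityTheory
open scoped ENNReal ContDiff Nat

noncomputable section

/-- The standard Gaussian measure `γ` on `ℝ`. -/
abbrev stdGauss : Measure ℝ := gaussianReal 0 1

/-- `h` is the weak derivative of order `k` of `f` on `ℝ` (both locally integrable with respect to
Lebesgue measure), tested against smooth compactly supported functions. -/
def IsWeakDeriv (k : ℕ) (f h : ℝ → ℝ) : Prop :=
  LocallyIntegrable f ∧ LocallyIntegrable h ∧
    ∀ u : ℝ → ℝ, ContDiff ℝ ∞ u → HasCompactSupport u →
      ∫ x, f x * iteratedDeriv k u x = (-1) ^ k * ∫ x, h x * u x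

/-- Membership in the Gaussian Sobolev space `𝔻^{k,p}(ℝ, γ)`: `f` is in `L^p(γ)`, it is `k` times
weakly differentiable, and its weak derivatives of orders `1, …, k` are in `L^p(γ)`. -/
def MemGaussianSobolev (k : ℕ) (p : ℝ≥0∞) (f : ℝ → ℝ) : Prop :=
  MemLp f p stdGauss ∧
    ∀ i : ℕ, 1 ≤ i → i ≤ k → ∃ h : ℝ → ℝ, IsWeakDeriv i f h ∧ MemLp h p stdGauss

/-- The `q`-th (probabilists') Hermite polynomial as a function on `ℝ`. -/
def hermiteFun (q : ℕ) (x : ℝ) : ℝ := Polynomial.aeval x (Polynomial.hermite q)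

/-- The `q`-th Hermite coefficient `c_q = (1 / q!) ∫ g H_q dγ` of `g`, so that
`g = ∑ c_q H_q` for `g ∈ L²(γ)`. -/
def hermiteCoeff (g : ℝ → ℝ) (q : ℕ) : ℝ :=
  (∫ x, g x * hermiteFun q x ∂stdGauss) / (q ! : ℝ)

lemma integrable_polynomial_stdGauss (p : Polynomial ℝ) :
    Integrable (fun x => p.eval x) stdGauss := by
  simp only [Polynomial.eval_eq_sum_range]
  refine integrable_finsetSum _ fun i _ => Integrable.const_mul ?_ _
  have h := integrable_pow_of_mem_interior_integrableExpSet (X := id) (μ := stdGauss)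
    (by simp [integrableExpSet_id_gaussianReal]) i
  simpa using h

lemma hermiteFun_eq (q : ℕ) (x : ℝ) :
    hermiteFun q x = ((Polynomial.hermite q).map (Int.castRingHom ℝ)).eval x := by
  simp [hermiteFun, Polynomial.aeval_def, Polynomial.eval_map]

lemma memLp_hermiteFun (q : ℕ) : MemLp (hermiteFun q) 2 stdGauss := by
  have hf : hermiteFun q = fun x => ((Polynomial.hermite q).map (Int.castRingHom ℝ)).eval x :=
    funext (hermiteFun_eq q)
  rw [hf, memLp_two_iff_integrable_sq]
  · have h := integrable_polynomial_stdGauss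
      (((Polynomial.hermite q).map (Int.castRingHom ℝ)) ^ 2)
    simp_rw [Polynomial.eval_pow] at h
    exact h
  · exact (Polynomial.continuous _).aestronglyMeasurable

/-- The Hermite polynomial `H_q` as an element of `L²(γ)`. -/
def hermiteL2 (q : ℕ) : Lp ℝ 2 stdGauss := (memLp_hermiteFun q).toLp

/-- The absolute value operator `A`: for `g ∈ L²(γ)` with Hermite coefficients `c_q`, `A(g)` is the
element `∑ |c_q| H_q` of `L²(γ)`. The series converges in `L²(γ)`, see `hasSum_absHermite`. -/
def absHermite (g : ℝ → ℝ) : Lp ℝ 2 stdGauss :=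
  ∑' q : ℕ, |hermiteCoeff g q| • hermiteL2 q

lemma integral_gaussian_ibp (p : Polynomial ℝ) :
    ∫ x, (Polynomial.X * p - Polynomial.derivative p).eval x ∂stdGauss = 0 := by
  have hint : ∀ r : Polynomial ℝ, Integrable (fun x => gaussianPDFReal 0 1 x * r.eval x) := by
    intro r
    have h := integrable_polynomial_stdGauss r
    rw [stdGauss, gaussianReal_of_var_ne_zero 0 (one_ne_zero)] at h
    rw [show gaussianPDF 0 1 = fun x => ENNReal.ofReal (gaussianPDFReal 0 1 x) from rfl,
      integrable_withDensity_iff_integrable_smul₀'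
        (measurable_gaussianPDFReal 0 1).ennreal_ofReal.aemeasurable (by simp)] at h
    refine h.congr (Filter.Eventually.of_forall fun x => ?_)
    simp [ENNReal.toReal_ofReal (gaussianPDFReal_nonneg 0 1 x)]
  rw [stdGauss, integral_gaussianReal_eq_integral_smul one_ne_zero]
  have hd : ∀ x, HasDerivAt (gaussianPDFReal 0 1) (-x * gaussianPDFReal 0 1 x) x := by
    intro x
    rw [show gaussianPDFReal 0 1 = fun x => (√(2 * Real.pi * (1 : NNReal)))⁻¹ *
      Real.exp (-(x - 0) ^ 2 / (2 * (1 : NNReal))) from rfl]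
    have h1 : HasDerivAt (fun x : ℝ => -(x - 0) ^ 2 / (2 * ((1 : NNReal) : ℝ))) (-x) x := by
      have := (((hasDerivAt_id x).sub_const 0).pow 2).neg.div_const (2 * ((1 : NNReal) : ℝ))
      refine this.congr_deriv ?_
      simp
      ring
    refine (h1.exp.const_mul ((√(2 * Real.pi * ((1 : NNReal) : ℝ)))⁻¹)).congr_deriv ?_
    ring
  have hkey : ∀ x, HasDerivAt (fun x => -(gaussianPDFReal 0 1 x * p.eval x))
      (gaussianPDFReal 0 1 x • (Polynomial.X * p - Polynomial.derivative p).eval x) x := by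
    intro x
    refine ((hd x).mul (p.hasDerivAt x)).neg.congr_deriv ?_
    simp
    ring
  exact integral_eq_zero_of_hasDerivAt_of_integrable hkey (hint _) (hint p).neg

lemma integral_hermiteFun_mul (m : ℕ) (p : Polynomial ℝ) :
    ∫ x, hermiteFun m x * p.eval x ∂stdGauss
      = ∫ x, (Polynomial.derivative^[m] p).eval x ∂stdGauss := by
  induction m generalizing p with
  | zero => simp [hermiteFun]
  | succ m ih =>
    rw [Function.iterate_succ_apply, ← ih, ← sub_eq_zero]
    simp only [hermiteFun_eq]
    set H := (Polynomial.hermite m).map (Int.castRingHom ℝ)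
    have hH : (Polynomial.hermite (m + 1)).map (Int.castRingHom ℝ)
        = Polynomial.X * H - Polynomial.derivative H := by
      simp [H, Polynomial.derivative_map]
    rw [hH, ← integral_sub, ← integral_gaussian_ibp (H * p)]
    · refine integral_congr_ae (Filter.Eventually.of_forall fun x => ?_)
      simp
      ring
    · have h := integrable_polynomial_stdGauss
        ((Polynomial.X * H - Polynomial.derivative H) * p)
      simp_rw [Polynomial.eval_mul (q := p)] at h
      exact h
    · have h := integrable_polynomial_stdGauss (H * Polynomial.derivative p)
      simp_rw [Polynomial.eval_mul] at h
      exact h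

lemma inner_hermiteL2 (m : ℕ) (g : Lp ℝ 2 stdGauss) :
    inner ℝ (hermiteL2 m) g = ∫ x, g x * hermiteFun m x ∂stdGauss := by
  rw [L2.inner_def]
  refine integral_congr_ae ?_
  filter_upwards [(memLp_hermiteFun m).coeFn_toLp] with x hx
  simp [hermiteL2, hx]

lemma inner_hermiteL2_hermiteL2 (m n : ℕ) :
    inner ℝ (hermiteL2 m) (hermiteL2 n) = if m = n then (n ! : ℝ) else 0 := by
  have key : ∀ m n : ℕ, inner ℝ (hermiteL2 m) (hermiteL2 n) = ∫ x, (Polynomial.derivative^[m]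
      ((Polynomial.hermite n).map (Int.castRingHom ℝ))).eval x ∂stdGauss := by
    intro m n
    rw [inner_hermiteL2, ← integral_hermiteFun_mul]
    refine integral_congr_ae ?_
    filter_upwards [(memLp_hermiteFun n).coeFn_toLp] with x hx
    rw [hermiteL2, hx, mul_comm, hermiteFun_eq n]
  have hdeg : ∀ n, ((Polynomial.hermite n).map (Int.castRingHom ℝ)).natDegree = n := by
    intro n
    rw [Polynomial.natDegree_map_eq_of_injective (RingHom.injective_int _),
      Polynomial.natDegree_hermite]
  have hlt : ∀ m n : ℕ, n < m → inner ℝ (hermiteL2 m) (hermiteL2 n) = 0 := by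
    intro m n h
    rw [key, Polynomial.iterate_derivative_eq_zero (by rw [hdeg]; exact h)]
    simp
  rcases lt_trichotomy m n with h | rfl | h
  · rw [if_neg h.ne, real_inner_comm, hlt n m h]
  · rw [if_pos rfl, key]
    have h0 : (Polynomial.derivative^[m]
        ((Polynomial.hermite m).map (Int.castRingHom ℝ))).natDegree = 0 := by
      have := Polynomial.natDegree_iterate_derivative
        ((Polynomial.hermite m).map (Int.castRingHom ℝ)) m
      rw [hdeg] at this
      omega
    rw [Polynomial.eq_C_of_natDegree_eq_zero h0, Polynomial.coeff_iterate_derivative]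
    simp [Polynomial.coeff_map, Nat.descFactorial_self]
  · rw [if_neg h.ne', hlt m n h]

/-- For `g ∈ L²(γ)` the series defining `A(g)` converges in `L²(γ)`. -/
lemma hasSum_absHermite {g : ℝ → ℝ} (hg : MemLp g 2 stdGauss) :
    HasSum (fun q : ℕ => |hermiteCoeff g q| • hermiteL2 q) (absHermite g) := by
  refine Summable.hasSum ?_
  set e : ℕ → Lp ℝ 2 stdGauss := fun q => (√(q ! : ℝ))⁻¹ • hermiteL2 q
  have hpos : ∀ q : ℕ, (0 : ℝ) < q ! := fun q => by positivity
  have he : Orthonormal ℝ e := by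
    rw [orthonormal_iff_ite]
    intro m n
    simp only [e, inner_smul_left, inner_smul_right, inner_hermiteL2_hermiteL2]
    split_ifs with h
    · subst h
      have h1 := Real.mul_self_sqrt (hpos m).le
      have h2 : √(m ! : ℝ) ≠ 0 := (Real.sqrt_pos.2 (hpos m)).ne'
      simp only [conj_trivial]
      field_simp
      nlinarith [h1]
    · simp
  have hcoef : ∀ q, |hermiteCoeff g q| • hermiteL2 q = ‖inner ℝ (e q) (hg.toLp)‖ • e q := by
    intro q
    have h1 : inner ℝ (hermiteL2 q) hg.toLp = hermiteCoeff g q * (q ! : ℝ) := by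
      rw [inner_hermiteL2, hermiteCoeff, div_mul_cancel₀ _ (hpos q).ne']
      refine integral_congr_ae ?_
      filter_upwards [hg.coeFn_toLp] with x hx
      rw [hx]
    have h2 := Real.mul_self_sqrt (hpos q).le
    have h3 : 0 < √(q ! : ℝ) := Real.sqrt_pos.2 (hpos q)
    simp only [e, inner_smul_left, h1, smul_smul, conj_trivial, Real.norm_eq_abs, abs_mul, abs_inv,
      abs_of_pos h3, abs_of_pos (hpos q)]
    congr 1
    field_simp
    rw [sq, h2]
  simp only [hcoef]
  have hs := he.orthogonalFamily.summable_iff_norm_sq_summable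
    (fun q => ‖inner ℝ (e q) (hg.toLp)‖)
  simp only [LinearIsometry.toSpanSingleton_apply] at hs
  refine hs.2 ?_
  simpa using he.inner_products_summable hg.toLp

end

/-! For `p > 2` the norm of `H_q` in `L^p(γ)` is at most `C q^(-1/4) √(q!) (p-1)^(q/2)`
(`exists_eLpNorm_hermiteFun_le`), which gains `q^(-1/4)` over plain hypercontractivity. To see this,
write `H_q` by Cauchy's formula as an average of `exp(xz - z²/2) z^(-q)` over the circle `|z| = r`.
Minkowski's inequality moves the norm inside, where it is a Gaussian moment generating function. At
the optimal radius the remaining angular integral is of order `q^(-1/2)`, and Stirling's formula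
gives back `q^(1/4)`.

Since `H_q^(i)` is a multiple of `H_(q-i)` of size at most `q^i`, the hypothesis makes the `i`-th
derivatives of the terms of `A(g)` absolutely summable in `L^p(γ)` for every `i ≤ ℓ`. Pairing with a
test function is continuous on `L^p(γ)`, so the sum is a weak derivative of `A(g)`
(`isWeakDeriv_of_hasSum`). The case `i = 0` identifies `A(g)` itself with an element of `L^p(γ)`. -/

/-! ### Inequalities from analysis: Minkowski, an angular integral, Stirling. -/

/-- Minkowski's integral inequality, with an upper bound for the inner norms. -/
theorem lintegral_rpow_lintegral_le {α β : Type*} [MeasurableSpace α] [MeasurableSpace β]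
    (μ : Measure α) (ν : Measure β) [SFinite μ] [SFinite ν] {p : ℝ} (hp : 1 < p)
    {F : α → β → ℝ≥0∞} (hF : Measurable (Function.uncurry F))
    {N : β → ℝ≥0∞} (hN : Measurable N) (hN0 : ∀ t, N t ≠ 0) (hNtop : ∀ t, N t ≠ ⊤)
    (h : ∀ t, ∫⁻ x, F x t ^ p ∂μ ≤ N t ^ p) :
    ∫⁻ x, (∫⁻ t, F x t ∂ν) ^ p ∂μ ≤ (∫⁻ t, N t ∂ν) ^ p := by
  have hpq := Real.HolderConjugate.conjExponent hp
  set q := p.conjExponent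
  have hp0 : 0 < p := hpq.pos
  have hq0 : 0 < q := hpq.symm.pos
  have hdiv : p / q = p - 1 := hpq.div_conj_eq_sub_one
  have hmeas : ∀ x, Measurable (F x) := fun x => hF.comp measurable_prodMk_left
  have hpt : ∀ x, (∫⁻ t, F x t ∂ν) ^ p
      ≤ (∫⁻ t, F x t ^ p * N t ^ (1 - p) ∂ν) * (∫⁻ t, N t ∂ν) ^ (p - 1) := by
    intro x
    -- Hölder with weight `N`: split `F = (F N^(-1/q)) N^(1/q)`. After Tonelli the weight `N^(1-p)`
    -- cancels the bound `N^p` down to `N`.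
    have hH := ENNReal.lintegral_mul_le_Lp_mul_Lq ν hpq
      (f := fun t => F x t * N t ^ (-(1 / q))) (g := fun t => N t ^ (1 / q))
      ((hmeas x).mul (hN.pow_const _)).aemeasurable (hN.pow_const _).aemeasurable
    have h1 : ∀ t, ((fun t => F x t * N t ^ (-(1 / q))) * fun t => N t ^ (1 / q)) t = F x t := by
      intro t
      simp only [Pi.mul_apply]
      rw [mul_assoc, ← ENNReal.rpow_add _ _ (hN0 t) (hNtop t)]
      simp
    have h2 : ∀ t, (F x t * N t ^ (-(1 / q))) ^ p = F x t ^ p * N t ^ (1 - p) := by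
      intro t
      rw [ENNReal.mul_rpow_of_nonneg _ _ hp0.le, ← ENNReal.rpow_mul]
      congr 2
      rw [show -(1 / q) * p = -(p / q) by ring, hdiv]
      ring
    have h3 : ∀ t, (N t ^ (1 / q)) ^ q = N t := by
      intro t
      rw [← ENNReal.rpow_mul, one_div_mul_cancel hq0.ne', ENNReal.rpow_one]
    simp only [h1, h2, h3] at hH
    refine (ENNReal.rpow_le_rpow hH hp0.le).trans_eq ?_
    rw [ENNReal.mul_rpow_of_nonneg _ _ hp0.le, ← ENNReal.rpow_mul, ← ENNReal.rpow_mul,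
      one_div_mul_cancel hp0.ne', ENNReal.rpow_one, one_div_mul_eq_div, hdiv]
  have hFp : Measurable (Function.uncurry fun x t => F x t ^ p * N t ^ (1 - p)) :=
    (hF.pow_const p).mul ((hN.pow_const _).comp measurable_snd)
  calc ∫⁻ x, (∫⁻ t, F x t ∂ν) ^ p ∂μ
      ≤ ∫⁻ x, (∫⁻ t, F x t ^ p * N t ^ (1 - p) ∂ν) * (∫⁻ t, N t ∂ν) ^ (p - 1) ∂μ :=
        lintegral_mono hpt
    _ = (∫⁻ t, (∫⁻ x, F x t ^ p ∂μ) * N t ^ (1 - p) ∂ν) * (∫⁻ t, N t ∂ν) ^ (p - 1) := by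
        rw [lintegral_mul_const _ hFp.lintegral_prod_right, lintegral_lintegral_swap hFp.aemeasurable]
        congr 1
        refine lintegral_congr fun t => ?_
        exact lintegral_mul_const _ ((hF.comp measurable_prodMk_right).pow_const p)
    _ ≤ (∫⁻ t, N t ∂ν) * (∫⁻ t, N t ∂ν) ^ (p - 1) := by
        gcongr with t
        refine (mul_le_mul_left (h t) _).trans_eq ?_
        rw [← ENNReal.rpow_add _ _ (hN0 t) (hNtop t), add_sub_cancel, ENNReal.rpow_one]
    _ = (∫⁻ t, N t ∂ν) ^ p := by
        conv_lhs => enter [1]; rw [← ENNReal.rpow_one (∫⁻ t, N t ∂ν)]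
        rw [← ENNReal.rpow_add_of_nonneg _ _ zero_le_one (by linarith)]
        congr 1
        ring

/-- The integrand is `π`-periodic, and `|sin t| ≥ 2|t|/π` on `[-π/2, π/2]` dominates it there by a
Gaussian. The decay `a^(-1/2)` produces the negative power of `q` in the norm bound. -/
theorem integral_exp_neg_mul_sin_sq_le {a : ℝ} (ha : 0 < a) :
    ∫ t in (0 : ℝ)..2 * Real.pi, Real.exp (-a * Real.sin t ^ 2)
      ≤ Real.pi * √(Real.pi / a) := by
  set f : ℝ → ℝ := fun t => Real.exp (-a * Real.sin t ^ 2)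
  have hf : Continuous f := by fun_prop
  have hper : Function.Periodic f Real.pi := fun t => by simp [f, Real.sin_add_pi]
  have h1 : ∫ t in (0 : ℝ)..2 * Real.pi, f t = 2 * ∫ t in (-(Real.pi / 2))..Real.pi / 2, f t := by
    rw [← intervalIntegral.integral_add_adjacent_intervals (b := Real.pi)
      (hf.intervalIntegrable _ _) (hf.intervalIntegrable _ _)]
    have e1 := hper.intervalIntegral_add_eq 0 (-(Real.pi / 2))
    have e2 := hper.intervalIntegral_add_eq Real.pi (-(Real.pi / 2))
    rw [show -(Real.pi / 2) + Real.pi = Real.pi / 2 by ring] at e1 e2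
    rw [zero_add] at e1
    rw [two_mul Real.pi, e1, e2]
    ring
  set b : ℝ := 4 * a / Real.pi ^ 2
  have hb : 0 < b := by positivity
  have hint := integrable_exp_neg_mul_sq hb
  have h2 : ∫ t in (-(Real.pi / 2))..Real.pi / 2, f t
      ≤ ∫ t in (-(Real.pi / 2))..Real.pi / 2, Real.exp (-b * t ^ 2) := by
    refine intervalIntegral.integral_mono_on (by linarith [Real.pi_pos])
      (hf.intervalIntegrable _ _) hint.intervalIntegrable fun t ht => ?_
    have hc := Real.mul_abs_le_abs_sin (abs_le.2 ht)
    have hsq := pow_le_pow_left₀ (by positivity) hc 2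
    rw [mul_pow, sq_abs, sq_abs] at hsq
    refine Real.exp_le_exp.2 ?_
    have hb' : b * t ^ 2 = a * ((2 / Real.pi) ^ 2 * t ^ 2) := by
      simp only [b]
      ring
    nlinarith
  have h3 : ∫ t in (-(Real.pi / 2))..Real.pi / 2, Real.exp (-b * t ^ 2)
      ≤ ∫ t, Real.exp (-b * t ^ 2) := by
    rw [intervalIntegral.integral_of_le (by linarith [Real.pi_pos])]
    exact setIntegral_le_integral hint (Filter.Eventually.of_forall fun t => (Real.exp_pos _).le)
  rw [integral_gaussian] at h3
  have h4 : 2 * √(Real.pi / b) = Real.pi * √(Real.pi / a) := by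
    rw [show Real.pi / b = (Real.pi / 2) ^ 2 * (Real.pi / a) by simp only [b]; field_simp; ring,
      Real.sqrt_mul (by positivity), Real.sqrt_sq (by positivity)]
    ring
  calc _ = 2 * ∫ t in (-(Real.pi / 2))..Real.pi / 2, f t := h1
    _ ≤ 2 * √(Real.pi / b) := by linarith
    _ = _ := h4

/-- The Stirling sequence decreases, so it is bounded by its first term `e/√2`. -/
theorem factorial_le_exp_one_mul_stirling {n : ℕ} (hn : n ≠ 0) :
    (n ! : ℝ) ≤ Real.exp 1 * √n * (n / Real.exp 1) ^ n := by
  obtain ⟨m, rfl⟩ := Nat.exists_eq_succ_of_ne_zero hn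
  have h := Stirling.stirlingSeq'_antitone (Nat.zero_le m)
  simp only [Function.comp, Nat.succ_eq_add_one, zero_add, Stirling.stirlingSeq_one] at h
  rw [Stirling.stirlingSeq, div_le_iff₀ (by positivity), Real.sqrt_mul (by norm_num)] at h
  refine h.trans_eq ?_
  have : √(2 : ℝ) ≠ 0 := by positivity
  field_simp

/-! ### Derivatives and recurrence of the Hermite polynomials. -/

theorem derivative_hermite_succ (n : ℕ) :
    Polynomial.derivative (Polynomial.hermite (n + 1)) = (n + 1 : ℤ) • Polynomial.hermite n := by
  induction n with
  | zero => simp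
  | succ n ih =>
    rw [Polynomial.hermite_succ, Polynomial.derivative_sub, Polynomial.derivative_mul, ih,
      Polynomial.derivative_smul, Polynomial.hermite_succ n]
    simp only [Polynomial.derivative_X, one_mul, zsmul_eq_mul]
    push_cast
    ring

theorem hermiteFun_add_two (n : ℕ) (x : ℝ) :
    hermiteFun (n + 2) x = x * hermiteFun (n + 1) x - (n + 1) * hermiteFun n x := by
  simp only [hermiteFun]
  rw [Polynomial.hermite_succ (n + 1), derivative_hermite_succ]
  simp

theorem iterate_derivative_hermite (q i : ℕ) :
    Polynomial.derivative^[i] (Polynomial.hermite q)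
      = (q.descFactorial i : ℤ) • Polynomial.hermite (q - i) := by
  induction i with
  | zero => simp
  | succ i ih =>
    rw [Function.iterate_succ_apply', ih, Polynomial.derivative_smul, Nat.descFactorial_succ]
    rcases h : q - i with _ | m
    · simp
    · rw [derivative_hermite_succ, smul_smul, show q - (i + 1) = m by omega]
      push_cast
      ring_nf

/-! ### Cauchy's formula on a circle. -/

/-- The derivative of `exp(xz - z²/2) z^(-k)` along the closed circle integrates to zero. The
resulting relation is the Hermite three-term recurrence up to factorials, so Cauchy's formula
follows by induction without differentiating a generating function. -/
theorem integral_exp_mul_circleMap_zpow_succ {r : ℝ} (hr : 0 < r) (x : ℝ) (k : ℤ) :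
    (k : ℂ) * ∫ t in (0 : ℝ)..2 * Real.pi,
        Complex.exp (x * circleMap 0 r t - circleMap 0 r t ^ 2 / 2) * circleMap 0 r t ^ (-k)
      = x * (∫ t in (0 : ℝ)..2 * Real.pi,
        Complex.exp (x * circleMap 0 r t - circleMap 0 r t ^ 2 / 2) * circleMap 0 r t ^ (1 - k))
      - ∫ t in (0 : ℝ)..2 * Real.pi,
        Complex.exp (x * circleMap 0 r t - circleMap 0 r t ^ 2 / 2) * circleMap 0 r t ^ (2 - k) := by
  have hz : ∀ t, circleMap 0 r t ≠ 0 := fun t => circleMap_ne_center hr.ne'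
  have hzc : Continuous (circleMap 0 r) := continuous_circleMap 0 r
  have hcont : ∀ m : ℤ, Continuous fun t =>
      Complex.exp (x * circleMap 0 r t - circleMap 0 r t ^ 2 / 2) * circleMap 0 r t ^ m := fun m =>
    (Continuous.cexp (by fun_prop)).mul (hzc.zpow₀ m fun t => Or.inl (hz t))
  have hd : ∀ t, HasDerivAt (fun t =>
      Complex.exp (x * circleMap 0 r t - circleMap 0 r t ^ 2 / 2) * circleMap 0 r t ^ (-k))
      (Complex.I * (x * (Complex.exp (x * circleMap 0 r t - circleMap 0 r t ^ 2 / 2)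
          * circleMap 0 r t ^ (1 - k))
        - Complex.exp (x * circleMap 0 r t - circleMap 0 r t ^ 2 / 2) * circleMap 0 r t ^ (2 - k)
        - k * (Complex.exp (x * circleMap 0 r t - circleMap 0 r t ^ 2 / 2)
          * circleMap 0 r t ^ (-k)))) t := by
    intro t
    have h1 := hasDerivAt_circleMap 0 r t
    have h2 : HasDerivAt (fun t => (x : ℂ) * circleMap 0 r t - circleMap 0 r t ^ 2 / 2)
        (x * (circleMap 0 r t * Complex.I) - circleMap 0 r t * (circleMap 0 r t * Complex.I)) t := by
      refine ((h1.const_mul (x : ℂ)).sub ((h1.pow 2).div_const 2)).congr_deriv ?_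
      push_cast
      ring
    have h3 := (hasDerivAt_zpow (-k) (circleMap 0 r t) (Or.inl (hz t))).comp t h1
    refine (h2.cexp.mul h3).congr_deriv ?_
    have e1 : circleMap 0 r t ^ (1 - k) = circleMap 0 r t * circleMap 0 r t ^ (-k) := by
      rw [sub_eq_add_neg, zpow_add₀ (hz t), zpow_one]
    have e2 : circleMap 0 r t ^ (2 - k) = circleMap 0 r t ^ 2 * circleMap 0 r t ^ (-k) := by
      rw [sub_eq_add_neg, zpow_add₀ (hz t)]
      rfl
    have e3 : circleMap 0 r t ^ (-k - 1) * circleMap 0 r t = circleMap 0 r t ^ (-k) := by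
      rw [zpow_sub_one₀ (hz t), inv_mul_cancel_right₀ (hz t)]
    simp only [Function.comp, e1, e2]
    push_cast
    linear_combination (-(k : ℂ)) * Complex.exp (x * circleMap 0 r t - circleMap 0 r t ^ 2 / 2)
      * Complex.I * e3
  have hI := intervalIntegral.integral_eq_sub_of_hasDerivAt (a := 0) (b := 2 * Real.pi)
    (fun t _ => hd t) (Continuous.intervalIntegrable (by
      have := hcont (1 - k); have := hcont (2 - k); have := hcont (-k); fun_prop) _ _)
  have hper : circleMap 0 r (2 * Real.pi) = circleMap 0 r 0 := by
    have := periodic_circleMap 0 r 0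
    rwa [zero_add] at this
  rw [hper, sub_self, intervalIntegral.integral_const_mul, intervalIntegral.integral_sub,
    intervalIntegral.integral_sub, intervalIntegral.integral_const_mul,
    intervalIntegral.integral_const_mul] at hI
  · have := (mul_eq_zero.1 hI).resolve_left Complex.I_ne_zero
    linear_combination -this
  all_goals
    refine Continuous.intervalIntegrable ?_ _ _
    have := hcont (1 - k); have := hcont (2 - k); have := hcont (-k); fun_prop

theorem integral_comp_circleMap_zero {f : ℂ → ℂ} (hf : Differentiable ℂ f) (r : ℝ) :
    ∫ t in (0 : ℝ)..2 * Real.pi, f (circleMap 0 r t) = 2 * Real.pi * f 0 := by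
  have h := (hf.diffContOnCl (s := Metric.ball 0 |r|)).circleAverage
  rw [Real.circleAverage_def, Complex.real_smul] at h
  rw [← h]
  push_cast
  have : (Real.pi : ℂ) ≠ 0 := by exact_mod_cast Real.pi_ne_zero
  field_simp

/-- Cauchy's formula for the Hermite polynomials. -/
theorem integral_exp_mul_circleMap_zpow_eq_hermiteFun {r : ℝ} (hr : 0 < r) (x : ℝ) (q : ℕ) :
    (q ! : ℂ) * ∫ t in (0 : ℝ)..2 * Real.pi,
        Complex.exp (x * circleMap 0 r t - circleMap 0 r t ^ 2 / 2) * circleMap 0 r t ^ (-(q : ℤ))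
      = 2 * Real.pi * hermiteFun q x := by
  have h0 : ∫ t in (0 : ℝ)..2 * Real.pi,
      Complex.exp (x * circleMap 0 r t - circleMap 0 r t ^ 2 / 2) * circleMap 0 r t ^ (0 : ℤ)
      = 2 * Real.pi := by
    have := integral_comp_circleMap_zero
      (f := fun z => Complex.exp (x * z - z ^ 2 / 2)) (by fun_prop) r
    simpa using this
  have h1 : ∫ t in (0 : ℝ)..2 * Real.pi,
      Complex.exp (x * circleMap 0 r t - circleMap 0 r t ^ 2 / 2) * circleMap 0 r t ^ (1 : ℤ)
      = 0 := by
    have := integral_comp_circleMap_zero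
      (f := fun z => Complex.exp (x * z - z ^ 2 / 2) * z) (by fun_prop) r
    simpa using this
  induction q using Nat.twoStepInduction with
  | zero =>
    simp only [Nat.factorial_zero, Nat.cast_zero, neg_zero, h0]
    simp [hermiteFun]
  | one =>
    have h := integral_exp_mul_circleMap_zpow_succ hr x 1
    rw [show (1 : ℤ) - 1 = 0 by norm_num, show (2 : ℤ) - 1 = 1 by norm_num, h0, h1] at h
    simp only [Int.cast_one, one_mul, sub_zero] at h
    simp only [Nat.factorial_one, Nat.cast_one, one_mul, h]
    simp [hermiteFun]
    ring
  | more q ih ih1 =>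
    -- Multiplied by `(q+1)!`, this relation matches `hermiteFun_add_two` term by term.
    have h := integral_exp_mul_circleMap_zpow_succ hr x (q + 2 : ℤ)
    rw [show (1 : ℤ) - (q + 2) = -((q + 1 : ℕ) : ℤ) by push_cast; ring,
      show (2 : ℤ) - (q + 2) = -(q : ℤ) by ring] at h
    rw [show (((q + 2 : ℕ) : ℤ)) = (q + 2 : ℤ) by push_cast; ring, hermiteFun_add_two]
    rw [Nat.factorial_succ] at ih1 ⊢
    rw [Nat.factorial_succ]
    push_cast at h ih ih1 ⊢
    linear_combination (q + 1 : ℂ) * (q ! : ℂ) * h + (x : ℂ) * ih1 - (q + 1 : ℂ) * ih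

/-- Pointwise bound of a Hermite polynomial by an integral over the circle of radius `r`. -/
theorem abs_hermiteFun_le_integral {r : ℝ} (hr : 0 < r) (x : ℝ) (q : ℕ) :
    |hermiteFun q x| ≤ ∫ t in (0 : ℝ)..2 * Real.pi, (q ! : ℝ) / (2 * Real.pi * r ^ q) *
      Real.exp (x * (r * Real.cos t) - r ^ 2 * Real.cos (2 * t) / 2) := by
  have h := congrArg norm (integral_exp_mul_circleMap_zpow_eq_hermiteFun hr x q)
  have hnorm : ∀ t, ‖Complex.exp (x * circleMap 0 r t - circleMap 0 r t ^ 2 / 2)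
      * circleMap 0 r t ^ (-(q : ℤ))‖
      = Real.exp (x * (r * Real.cos t) - r ^ 2 * Real.cos (2 * t) / 2) * (r ^ q)⁻¹ := by
    intro t
    rw [norm_mul, Complex.norm_exp, norm_zpow, norm_circleMap_zero, abs_of_pos hr, zpow_neg,
      zpow_natCast]
    congr 2
    have hc : circleMap 0 r t = (r * Real.cos t : ℝ) + (r * Real.sin t : ℝ) * Complex.I := by
      rw [circleMap, zero_add, Complex.exp_mul_I]
      push_cast
      ring
    rw [hc, Real.cos_two_mul']
    simp [sq, -Complex.ofReal_cos, -Complex.ofReal_sin]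
    ring
  rw [norm_mul, norm_mul, Complex.norm_natCast, Complex.norm_real, Real.norm_eq_abs] at h
  have hpi : ‖(2 * Real.pi : ℂ)‖ = 2 * Real.pi := by
    simp [abs_of_pos Real.pi_pos]
  rw [hpi] at h
  have hle := intervalIntegral.norm_integral_le_integral_norm (μ := volume)
    (f := fun t => Complex.exp (x * circleMap 0 r t - circleMap 0 r t ^ 2 / 2)
      * circleMap 0 r t ^ (-(q : ℤ))) (Real.two_pi_pos.le)
  simp only [hnorm] at hle
  rw [intervalIntegral.integral_mul_const] at hle
  rw [intervalIntegral.integral_const_mul]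
  have hp := Real.pi_pos
  have h5 : 2 * Real.pi * |hermiteFun q x| ≤ q ! * ((∫ t in (0 : ℝ)..2 * Real.pi,
      Real.exp (x * (r * Real.cos t) - r ^ 2 * Real.cos (2 * t) / 2)) * (r ^ q)⁻¹) := by
    rw [← h]
    gcongr
  rw [div_mul_eq_mul_div, le_div_iff₀ (by positivity)]
  have hrq : 0 < r ^ q := by positivity
  calc _ = (2 * Real.pi * |hermiteFun q x|) * r ^ q := by ring
    _ ≤ _ := mul_le_mul_of_nonneg_right h5 hrq.le
    _ = _ := by rw [mul_assoc, inv_mul_cancel_right₀ hrq.ne']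

/-! ### Growth of the `L^p(γ)` norms of the Hermite polynomials. -/

theorem continuous_hermiteFun (q : ℕ) : Continuous (hermiteFun q) := by
  rw [show hermiteFun q = fun x => ((Polynomial.hermite q).map (Int.castRingHom ℝ)).eval x from
    funext (hermiteFun_eq q)]
  exact Polynomial.continuous _

theorem lintegral_exp_linear_stdGauss_rpow {p c : ℝ} (hp : 0 < p) (hc : 0 < c) (a b : ℝ) :
    ∫⁻ x, ENNReal.ofReal (c * Real.exp (x * a - b)) ^ p ∂stdGauss
      = ENNReal.ofReal (c * Real.exp (p * a ^ 2 / 2 - b)) ^ p := by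
  have h1 : ∀ x : ℝ, ENNReal.ofReal (c * Real.exp (x * a - b)) ^ p
      = ENNReal.ofReal (c ^ p * Real.exp (-(p * b)) * Real.exp (p * a * x)) := by
    intro x
    rw [ENNReal.ofReal_rpow_of_nonneg (by positivity) hp.le,
      Real.mul_rpow hc.le (Real.exp_pos _).le, ← Real.exp_mul, mul_assoc, ← Real.exp_add]
    congr 3
    ring
  have hint : Integrable (fun x => Real.exp (p * a * x)) stdGauss :=
    integrable_exp_mul_gaussianReal _
  simp only [h1]
  rw [← ofReal_integral_eq_lintegral_ofReal (hint.const_mul _)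
    (Filter.Eventually.of_forall fun x => by positivity), integral_const_mul]
  have hm : ∫ x, Real.exp (p * a * x) ∂stdGauss = Real.exp ((p * a) ^ 2 / 2) := by
    have := congrFun (mgf_fun_id_gaussianReal (μ := 0) (v := 1)) (p * a)
    simpa [mgf] using this
  rw [hm, ENNReal.ofReal_rpow_of_nonneg (by positivity) hp.le,
    Real.mul_rpow hc.le (Real.exp_pos _).le, ← Real.exp_mul, mul_assoc, ← Real.exp_add]
  congr 3
  ring

/-- Minkowski is applied to the circle bound. The exponent at angle `t` becomes `p r² cos² t / 2 -
r² cos(2t) / 2 = (p-1) r²/2 - (p-2) r² sin² t / 2`, which peaks at `sin t = 0` when `p > 2`. -/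
theorem eLpNorm_hermiteFun_le_integral {p r : ℝ} (hp : 1 < p) (hr : 0 < r) (q : ℕ) :
    eLpNorm (hermiteFun q) (ENNReal.ofReal p) stdGauss
      ≤ ENNReal.ofReal ((q ! : ℝ) / (2 * Real.pi * r ^ q) * Real.exp ((p - 1) * r ^ 2 / 2) *
        ∫ t in (0 : ℝ)..2 * Real.pi, Real.exp (-((p - 2) * r ^ 2 / 2) * Real.sin t ^ 2)) := by
  have hp0 : 0 < p := by linarith
  set c : ℝ := (q ! : ℝ) / (2 * Real.pi * r ^ q)
  have hc : 0 < c := by have := Real.pi_pos; positivity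
  set ν : Measure ℝ := volume.restrict (Set.Ioc 0 (2 * Real.pi))
  set F : ℝ → ℝ → ℝ≥0∞ := fun x t =>
    ENNReal.ofReal (c * Real.exp (x * (r * Real.cos t) - r ^ 2 * Real.cos (2 * t) / 2))
  set n : ℝ → ℝ := fun t =>
    c * Real.exp (p * (r * Real.cos t) ^ 2 / 2 - r ^ 2 * Real.cos (2 * t) / 2)
  have hn : Continuous n := by fun_prop
  have hn0 : ∀ t, 0 < n t := fun t => by positivity
  have hM := lintegral_rpow_lintegral_le stdGauss ν hp (F := F) (N := fun t => ENNReal.ofReal (n t))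
    (by
      refine Measurable.ennreal_ofReal (Continuous.measurable ?_)
      fun_prop)
    hn.measurable.ennreal_ofReal (fun t => by simp [hn0 t]) (fun t => by simp)
    (fun t => (lintegral_exp_linear_stdGauss_rpow hp0 hc _ _).le)
  have hbound : ∀ x, ‖hermiteFun q x‖ₑ ≤ ∫⁻ t, F x t ∂ν := by
    intro x
    rw [Real.enorm_eq_ofReal_abs]
    refine (ENNReal.ofReal_le_ofReal (abs_hermiteFun_le_integral hr x q)).trans_eq ?_
    rw [intervalIntegral.integral_of_le Real.two_pi_pos.le, ofReal_integral_eq_lintegral_ofReal]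
    · exact (Continuous.integrableOn_Icc (by fun_prop)).mono_set Set.Ioc_subset_Icc_self
    · exact Filter.Eventually.of_forall fun t => by positivity
  have hN : ∫⁻ t, ENNReal.ofReal (n t) ∂ν = ENNReal.ofReal (c * Real.exp ((p - 1) * r ^ 2 / 2) *
      ∫ t in (0 : ℝ)..2 * Real.pi, Real.exp (-((p - 2) * r ^ 2 / 2) * Real.sin t ^ 2)) := by
    rw [← ofReal_integral_eq_lintegral_ofReal
      (hn.integrableOn_Icc.mono_set Set.Ioc_subset_Icc_self)
      (Filter.Eventually.of_forall fun t => (hn0 t).le), ← intervalIntegral.integral_const_mul,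
      intervalIntegral.integral_of_le Real.two_pi_pos.le]
    congr 1
    refine integral_congr_ae (Filter.Eventually.of_forall fun t => ?_)
    simp only [n]
    rw [mul_assoc, ← Real.exp_add, Real.cos_two_mul, mul_pow, Real.cos_sq']
    congr 2
    ring
  rw [← hN, eLpNorm_eq_lintegral_rpow_enorm_toReal (by simpa using hp0) ENNReal.ofReal_ne_top,
    ENNReal.toReal_ofReal hp0.le]
  calc _ ≤ ((∫⁻ t, ENNReal.ofReal (n t) ∂ν) ^ p) ^ (1 / p) := by
        refine ENNReal.rpow_le_rpow ((lintegral_mono fun x => ?_).trans hM) (by positivity)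
        exact ENNReal.rpow_le_rpow (hbound x) hp0.le
    _ = _ := by rw [← ENNReal.rpow_mul, mul_one_div_cancel hp0.ne', ENNReal.rpow_one]

/-- The growth of the `L^p` norms of the Hermite polynomials for `p > 2`. -/
theorem exists_eLpNorm_hermiteFun_le {p : ℝ} (hp : 2 < p) :
    ∃ C : ℝ, 0 < C ∧ ∀ q : ℕ, q ≠ 0 → eLpNorm (hermiteFun q) (ENNReal.ofReal p) stdGauss
      ≤ ENNReal.ofReal (C * (q : ℝ) ^ (-(1 / 4) : ℝ) * √(q ! : ℝ) * (p - 1) ^ ((q : ℝ) / 2)) := by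
  have hp1 : 0 < p - 1 := by linarith
  have hp2 : 0 < p - 2 := by linarith
  have hpi := Real.pi_pos
  -- `√e` comes from Stirling, the other root from the angular integral, and `1/2` from `π / (2π)`.
  refine ⟨√(Real.exp 1) / 2 * √(2 * Real.pi * (p - 1) / (p - 2)), by positivity, fun q hq => ?_⟩
  have hq0 : (0 : ℝ) < q := by positivity
  -- This radius minimizes `r^(-q) exp((p-1) r²/2)`.
  have hr : 0 < √(q / (p - 1)) := by positivity
  refine (eLpNorm_hermiteFun_le_integral (by linarith) hr q).trans (ENNReal.ofReal_le_ofReal ?_)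
  have hsin := integral_exp_neg_mul_sin_sq_le (a := (p - 2) * √(q / (p - 1)) ^ 2 / 2)
    (by positivity)
  refine (mul_le_mul_of_nonneg_left hsin (by positivity)).trans ?_
  rw [Real.sq_sqrt (by positivity)]
  have hfac : √(q ! : ℝ) ≤ √(Real.exp 1) * (q : ℝ) ^ (1 / 4 : ℝ) * √((q / Real.exp 1) ^ q) := by
    refine (Real.sqrt_le_sqrt (factorial_le_exp_one_mul_stirling hq)).trans_eq ?_
    rw [Real.sqrt_mul (by positivity), Real.sqrt_mul (by positivity)]
    congr 2
    rw [Real.sqrt_eq_rpow, Real.sqrt_eq_rpow, ← Real.rpow_mul hq0.le]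
    norm_num
  have hpow : ∀ x : ℝ, 0 < x → √(x ^ q) = x ^ ((q : ℝ) / 2) := by
    intro x hx
    rw [Real.sqrt_eq_rpow, ← Real.rpow_natCast, ← Real.rpow_mul hx.le]
    congr 1
    ring
  have hexp : Real.exp ((p - 1) * (q / (p - 1)) / 2) = Real.exp 1 ^ ((q : ℝ) / 2) := by
    rw [← Real.exp_mul]
    congr 1
    field_simp
  have hrq : √(q / (p - 1)) ^ q = (q : ℝ) ^ ((q : ℝ) / 2) / (p - 1) ^ ((q : ℝ) / 2) := by
    rw [← Real.div_rpow hq0.le hp1.le, ← hpow _ (by positivity), Real.sqrt_eq_rpow,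
      Real.sqrt_eq_rpow, ← Real.rpow_natCast, ← Real.rpow_natCast, ← Real.rpow_mul (by positivity),
      ← Real.rpow_mul (by positivity), mul_comm]
  have hroot : √(Real.pi / ((p - 2) * (q / (p - 1)) / 2))
      = √(2 * Real.pi * (p - 1) / (p - 2)) * (q : ℝ) ^ (-(1 / 2) : ℝ) := by
    rw [Real.rpow_neg hq0.le, ← Real.sqrt_eq_rpow, ← Real.sqrt_inv, ← Real.sqrt_mul (by positivity)]
    congr 1
    field_simp
  rw [hpow _ (by positivity), Real.div_rpow hq0.le (Real.exp_pos 1).le] at hfac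
  rw [hexp, hrq, hroot, show (-(1 / 4) : ℝ) = 1 / 4 + -(1 / 2) by norm_num,
    Real.rpow_add hq0]
  -- Only one of the two factors `√(q!)` is estimated by Stirling; its `(q/e)^(q/2)` cancels against
  -- the radius and the exponential. The other stays in the bound.
  nth_rewrite 1 [← Real.mul_self_sqrt (Nat.cast_nonneg (α := ℝ) q !)]
  have hA : 0 < (q : ℝ) ^ ((q : ℝ) / 2) := by positivity
  have hB : 0 < (p - 1) ^ ((q : ℝ) / 2) := by positivity
  have hE : 0 < Real.exp 1 ^ ((q : ℝ) / 2) := by positivity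
  have hS : 0 < √(q ! : ℝ) := by positivity
  have hR : 0 < √(2 * Real.pi * (p - 1) / (p - 2)) := by positivity
  have hQ : 0 < (q : ℝ) ^ (-(1 / 2) : ℝ) := by positivity
  generalize (q : ℝ) ^ ((q : ℝ) / 2) = A at *
  generalize (p - 1) ^ ((q : ℝ) / 2) = B at *
  generalize Real.exp 1 ^ ((q : ℝ) / 2) = E at *
  generalize √(2 * Real.pi * (p - 1) / (p - 2)) = R at *
  generalize (q : ℝ) ^ (-(1 / 2) : ℝ) = Q at *
  generalize √(q ! : ℝ) = S at *
  calc S * S / (2 * Real.pi * (A / B)) * E * (Real.pi * (R * Q))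
      = S * (S * (B * E * R * Q / (2 * A))) := by field_simp
    _ ≤ S * ((√(Real.exp 1) * (q : ℝ) ^ (1 / 4 : ℝ) * (A / E)) * (B * E * R * Q / (2 * A))) := by
        gcongr
    _ = _ := by field_simp

/-! ### Weak derivatives and convergence in `L^p(γ)`. -/

theorem continuous_gaussianPDFReal_zero_one : Continuous (gaussianPDFReal 0 1) := by
  rw [gaussianPDFReal_def]
  fun_prop

/-- Integration against a continuous compactly supported function, with respect to Lebesgue
measure, is a continuous linear functional on `L^p(γ)`. -/
theorem exists_clm_eq_integral_mul {p : ℝ≥0∞} [Fact (1 ≤ p)] {v : ℝ → ℝ} (hv : Continuous v)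
    (hvs : HasCompactSupport v) :
    ∃ T : Lp ℝ p stdGauss →L[ℝ] ℝ, ∀ f : Lp ℝ p stdGauss, T f = ∫ x, f x * v x := by
  have hpos : ∀ x, 0 < gaussianPDFReal 0 1 x := fun x => gaussianPDFReal_pos 0 1 x one_ne_zero
  -- Dividing by the positive continuous density turns the Lebesgue pairing with `v` into the
  -- `γ`-pairing with `w`, which lies in the dual exponent space because its support is compact.
  set w : ℝ → ℝ := fun x => (gaussianPDFReal 0 1 x)⁻¹ * v x
  have hw : Continuous w := (continuous_gaussianPDFReal_zero_one.inv₀ fun x => (hpos x).ne').mul hv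
  have hws : HasCompactSupport w := hvs.mul_left
  have hwL : MemLp w p.conjExponent stdGauss := hw.memLp_of_hasCompactSupport hws
  have : Fact (1 ≤ p.conjExponent) := ⟨by simp [ENNReal.conjExponent]⟩
  refine ⟨((ContinuousLinearMap.mul ℝ ℝ).lpPairing stdGauss p p.conjExponent).flip hwL.toLp,
    fun f => ?_⟩
  rw [ContinuousLinearMap.flip_apply, ContinuousLinearMap.lpPairing_eq_integral]
  have h1 : ∫ x, (ContinuousLinearMap.mul ℝ ℝ) (f x) ((hwL.toLp w : Lp ℝ _ stdGauss) x) ∂stdGauss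
      = ∫ x, f x * w x ∂stdGauss := by
    refine integral_congr_ae ?_
    filter_upwards [hwL.coeFn_toLp] with x hx
    rw [hx, ContinuousLinearMap.mul_apply']
  rw [h1, integral_gaussianReal_eq_integral_smul one_ne_zero]
  refine integral_congr_ae (Filter.Eventually.of_forall fun x => ?_)
  have := (hpos x).ne'
  simp only [w, smul_eq_mul]
  field_simp

/-- The Gaussian density has a continuous, hence locally bounded, reciprocal. -/
theorem MeasureTheory.MemLp.locallyIntegrable_of_stdGauss {p : ℝ≥0∞} (hp : 1 ≤ p) {f : ℝ → ℝ}
    (hf : MemLp f p stdGauss) : LocallyIntegrable f := by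
  have h := hf.integrable hp
  rw [stdGauss, gaussianReal_of_var_ne_zero 0 one_ne_zero,
    show gaussianPDF 0 1 = fun x => ENNReal.ofReal (gaussianPDFReal 0 1 x) from rfl,
    integrable_withDensity_iff_integrable_smul₀'
      (measurable_gaussianPDFReal 0 1).ennreal_ofReal.aemeasurable (by simp)] at h
  have hpos : ∀ x, 0 < gaussianPDFReal 0 1 x := fun x => gaussianPDFReal_pos 0 1 x one_ne_zero
  have hc : Continuous fun x => (gaussianPDFReal 0 1 x)⁻¹ :=
    continuous_gaussianPDFReal_zero_one.inv₀ fun x => (hpos x).ne'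
  have h2 := h.locallyIntegrable.continuous_smul hc
  convert h2 using 2 with x
  rw [ENNReal.toReal_ofReal (hpos x).le, smul_smul, inv_mul_cancel₀ (hpos x).ne', one_smul]

theorem integral_eval_mul_iteratedDeriv (i : ℕ) (P : Polynomial ℝ) {u : ℝ → ℝ}
    (hu : ContDiff ℝ ∞ u) (hus : HasCompactSupport u) :
    ∫ x, P.eval x * iteratedDeriv i u x
      = (-1) ^ i * ∫ x, (Polynomial.derivative^[i] P).eval x * u x := by
  induction i generalizing u with
  | zero => simp
  | succ i ih =>
    have hu' : ContDiff ℝ ∞ (deriv u) := by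
      exact (contDiff_infty_iff_deriv.1 hu).2
    rw [iteratedDeriv_succ', ih hu' hus.deriv]
    have hint : ∀ (Q : Polynomial ℝ) {v : ℝ → ℝ}, Continuous v → HasCompactSupport v →
        Integrable ((fun x => Q.eval x) * v) := fun Q v hv hvs =>
      (Q.continuous.mul hv).integrable_of_hasCompactSupport hvs.mul_left
    rw [integral_mul_deriv_eq_deriv_mul_of_integrable
      (u' := fun x => (Polynomial.derivative^[i + 1] P).eval x)
      (fun x _ => by
        rw [Function.iterate_succ_apply']
        exact Polynomial.hasDerivAt _ x)
      (fun x _ => ((hu.differentiable (by simp)) x).hasDerivAt)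
      (hint _ hu'.continuous hus.deriv) (hint _ hu.continuous hus) (hint _ hu.continuous hus)]
    ring

/-- Series of polynomials may be differentiated weakly term by term if the series and the series of
derivatives converge in Gaussian Lebesgue spaces. -/
theorem isWeakDeriv_of_hasSum {p p' : ℝ≥0∞} [Fact (1 ≤ p)] [Fact (1 ≤ p')] (i : ℕ)
    {P : ℕ → Polynomial ℝ} {f : ℕ → Lp ℝ p stdGauss} {h : ℕ → Lp ℝ p' stdGauss}
    {F : Lp ℝ p stdGauss} {H : Lp ℝ p' stdGauss}
    (hf : ∀ q, f q =ᵐ[stdGauss] fun x => (P q).eval x)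
    (hh : ∀ q, h q =ᵐ[stdGauss] fun x => (Polynomial.derivative^[i] (P q)).eval x)
    (hF : HasSum f F) (hH : HasSum h H) : IsWeakDeriv i F H := by
  refine ⟨(Lp.memLp F).locallyIntegrable_of_stdGauss Fact.out,
    (Lp.memLp H).locallyIntegrable_of_stdGauss Fact.out, fun u hu hus => ?_⟩
  have hac := gaussianReal_absolutelyContinuous' 0 (v := 1) one_ne_zero
  have hui : Continuous (iteratedDeriv i u) :=
    hu.continuous_iteratedDeriv i (by exact_mod_cast le_top)
  have huis : HasCompactSupport (iteratedDeriv i u) := by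
    clear hui hf hh
    induction i with
    | zero => simpa using hus
    | succ i ih =>
      rw [iteratedDeriv_succ]
      exact ih.deriv
  obtain ⟨T, hT⟩ := exists_clm_eq_integral_mul (p := p) hui huis
  obtain ⟨S, hS⟩ := exists_clm_eq_integral_mul (p := p') hu.continuous hus
  rw [← hT, ← hS]
  have h1 := T.hasSum hF
  have h2 := (S.hasSum hH).mul_left ((-1) ^ i)
  -- The two series may live in different `L^p` spaces; they are compared only after pairing, as
  -- real series with equal terms.
  have hTS : (fun q => T (f q)) = fun q => (-1) ^ i * S (h q) := by
    funext q
    rw [hT, hS]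
    have e1 : ∫ x, f q x * iteratedDeriv i u x = ∫ x, (P q).eval x * iteratedDeriv i u x :=
      integral_congr_ae ((hac.ae_eq (hf q)).mul (Filter.EventuallyEq.refl _ _))
    have e2 : ∫ x, h q x * u x = ∫ x, (Polynomial.derivative^[i] (P q)).eval x * u x :=
      integral_congr_ae ((hac.ae_eq (hh q)).mul (Filter.EventuallyEq.refl _ _))
    rw [e1, e2, integral_eval_mul_iteratedDeriv i _ hu hus]
  rw [hTS] at h1
  exact h1.unique h2

/-- A function with a weak derivative of order zero agrees with it almost everywhere. -/
theorem IsWeakDeriv.ae_eq {f h : ℝ → ℝ} (hfh : IsWeakDeriv 0 f h) : f =ᵐ[volume] h := by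
  obtain ⟨hf, hh, H⟩ := hfh
  refine ae_eq_of_integral_contDiff_smul_eq hf hh fun u hu hus => ?_
  have := H u hu hus
  simp only [iteratedDeriv_zero, pow_zero, one_mul] at this
  simpa only [smul_eq_mul, mul_comm] using this

/-! ### Summability of the differentiated series and conclusion. -/

/-- The factor from differentiating `i` times is half absorbed by the factorial: `q!/(q-i)!` times
`√((q-i)!)` is `√(q!/(q-i)!) √(q!)`, at most `q^(i/2) √(q!)`. This is the source of the weight
`q^(ℓ/2)`. -/
theorem descFactorial_mul_sqrt_factorial_le {q i ℓ : ℕ} (hi : i ≤ ℓ) (hq : i < q) {b : ℝ}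
    (hb : 1 ≤ b) :
    (q.descFactorial i : ℝ) * (((q - i : ℕ) : ℝ) ^ (-(1 / 4) : ℝ) * √((q - i)! : ℝ) *
        b ^ (((q - i : ℕ) : ℝ) / 2))
      ≤ (i + 1 : ℝ) ^ (1 / 4 : ℝ) *
        ((q : ℝ) ^ ((ℓ : ℝ) / 2 - 1 / 4) * √(q ! : ℝ) * b ^ ((q : ℝ) / 2)) := by
  have hq1 : (1 : ℝ) ≤ q := by exact_mod_cast (by omega : 1 ≤ q)
  have hq0 : (0 : ℝ) < q := by linarith
  have hm0 : (0 : ℝ) < ((q - i : ℕ) : ℝ) := by exact_mod_cast (by omega : 0 < q - i)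
  have h1 : (q.descFactorial i : ℝ) * √((q - i)! : ℝ) ≤ (q : ℝ) ^ ((i : ℝ) / 2) * √(q ! : ℝ) := by
    have hd : (0 : ℝ) ≤ q.descFactorial i := Nat.cast_nonneg _
    have hle : (q.descFactorial i : ℝ) ≤ (q : ℝ) ^ i := by
      exact_mod_cast Nat.descFactorial_le_pow q i
    have hs : √((q : ℝ) ^ i) = (q : ℝ) ^ ((i : ℝ) / 2) := by
      rw [Real.sqrt_eq_rpow, ← Real.rpow_natCast, ← Real.rpow_mul hq0.le]
      congr 1
      ring
    have hfac : (q ! : ℝ) = q.descFactorial i * (q - i)! := by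
      rw [← Nat.factorial_mul_descFactorial hq.le]
      push_cast
      ring
    rw [← hs, hfac, Real.sqrt_mul hd, ← mul_assoc]
    gcongr
    calc (q.descFactorial i : ℝ) = √(q.descFactorial i) * √(q.descFactorial i) :=
          (Real.mul_self_sqrt hd).symm
      _ ≤ _ := by gcongr
  have h2 : ((q - i : ℕ) : ℝ) ^ (-(1 / 4) : ℝ)
      ≤ (i + 1 : ℝ) ^ (1 / 4 : ℝ) * (q : ℝ) ^ (-(1 / 4) : ℝ) := by
    -- Equality holds at `q = i + 1`, the least admissible `q`.
    have hle : (q : ℝ) / (i + 1) ≤ ((q - i : ℕ) : ℝ) := by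
      rw [div_le_iff₀ (by positivity)]
      obtain ⟨m, rfl⟩ := Nat.exists_eq_add_of_lt hq
      rw [show i + m + 1 - i = m + 1 by omega]
      push_cast
      nlinarith [mul_nonneg (Nat.cast_nonneg (α := ℝ) i) (Nat.cast_nonneg (α := ℝ) m)]
    refine (Real.rpow_le_rpow_of_nonpos (by positivity) hle (by norm_num)).trans_eq ?_
    rw [Real.div_rpow hq0.le (by positivity), Real.rpow_neg (by positivity : (0 : ℝ) ≤ i + 1),
      div_inv_eq_mul, mul_comm]
  have h3 : b ^ (((q - i : ℕ) : ℝ) / 2) ≤ b ^ ((q : ℝ) / 2) := by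
    refine Real.rpow_le_rpow_of_exponent_le hb ?_
    gcongr
    omega
  have h4 : (q : ℝ) ^ ((i : ℝ) / 2) * (q : ℝ) ^ (-(1 / 4) : ℝ) ≤ (q : ℝ) ^ ((ℓ : ℝ) / 2 - 1 / 4) := by
    rw [← Real.rpow_add hq0]
    refine Real.rpow_le_rpow_of_exponent_le hq1 ?_
    have : (i : ℝ) ≤ ℓ := by exact_mod_cast hi
    linarith
  calc _ = ((q.descFactorial i : ℝ) * √((q - i)! : ℝ)) * ((q - i : ℕ) : ℝ) ^ (-(1 / 4) : ℝ) *
        b ^ (((q - i : ℕ) : ℝ) / 2) := by ring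
    _ ≤ ((q : ℝ) ^ ((i : ℝ) / 2) * √(q ! : ℝ)) *
        ((i + 1 : ℝ) ^ (1 / 4 : ℝ) * (q : ℝ) ^ (-(1 / 4) : ℝ)) * b ^ ((q : ℝ) / 2) := by gcongr
    _ = (i + 1 : ℝ) ^ (1 / 4 : ℝ) * (((q : ℝ) ^ ((i : ℝ) / 2) * (q : ℝ) ^ (-(1 / 4) : ℝ)) *
        √(q ! : ℝ) * b ^ ((q : ℝ) / 2)) := by ring
    _ ≤ _ := by gcongr

/-- The series of `i`-th derivatives of `A(g)` converges in `L^p(γ)` to a weak derivative. -/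
theorem exists_isWeakDeriv_absHermite {ℓ i : ℕ} (hi : i ≤ ℓ) {p : ℝ} (hp : 2 < p) {g : ℝ → ℝ}
    (hg : MemLp g 2 stdGauss)
    (hsum : Summable fun q : ℕ =>
      |hermiteCoeff g q| * (q : ℝ) ^ ((ℓ : ℝ) / 2 - 1 / 4) * √(q ! : ℝ) *
        (p - 1) ^ ((q : ℝ) / 2)) :
    ∃ h : ℝ → ℝ, IsWeakDeriv i (absHermite g) h ∧ MemLp h (ENNReal.ofReal p) stdGauss := by
  obtain ⟨C, hC, hbound⟩ := exists_eLpNorm_hermiteFun_le hp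
  have hp1 : 0 < p - 1 := by linarith
  have : Fact (1 ≤ ENNReal.ofReal p) := ⟨by
    rw [← ENNReal.ofReal_one]
    exact ENNReal.ofReal_le_ofReal (by linarith)⟩
  have hmem : ∀ q, MemLp (hermiteFun q) (ENNReal.ofReal p) stdGauss := by
    intro q
    rcases eq_or_ne q 0 with rfl | hq
    · have : hermiteFun 0 = fun _ => (1 : ℝ) := by
        funext x
        simp [hermiteFun]
      rw [this]
      exact memLp_const 1
    · exact ⟨(continuous_hermiteFun q).aestronglyMeasurable,
        (hbound q hq).trans_lt ENNReal.ofReal_lt_top⟩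
  set E : ℕ → Lp ℝ (ENNReal.ofReal p) stdGauss := fun q => (hmem q).toLp
  have hE : ∀ q, q ≠ 0 → ‖E q‖
      ≤ C * ((q : ℝ) ^ (-(1 / 4) : ℝ) * √(q ! : ℝ) * (p - 1) ^ ((q : ℝ) / 2)) := by
    intro q hq
    rw [Lp.norm_toLp]
    refine ENNReal.toReal_le_of_le_ofReal (by positivity) ((hbound q hq).trans_eq ?_)
    congr 1
    ring
  -- For `q < i` the subtraction truncates, but the falling factorial is then zero.
  set h : ℕ → Lp ℝ (ENNReal.ofReal p) stdGauss := fun q =>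
    (|hermiteCoeff g q| * q.descFactorial i) • E (q - i)
  have hs : Summable h := by
    refine Summable.of_norm_bounded_eventually_nat
      (hsum.mul_left (C * (i + 1 : ℝ) ^ (1 / 4 : ℝ))) ?_
    -- The finitely many `q ≤ i` are dropped: the norm bound requires a positive index `q - i`.
    filter_upwards [Filter.eventually_gt_atTop i] with q hq
    rw [norm_smul, Real.norm_of_nonneg (by positivity)]
    calc |hermiteCoeff g q| * q.descFactorial i * ‖E (q - i)‖
        ≤ |hermiteCoeff g q| * q.descFactorial i * (C * (((q - i : ℕ) : ℝ) ^ (-(1 / 4) : ℝ) *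
          √((q - i)! : ℝ) * (p - 1) ^ (((q - i : ℕ) : ℝ) / 2))) := by
          gcongr
          exact hE _ (by omega)
      _ = |hermiteCoeff g q| * C * ((q.descFactorial i : ℝ) * (((q - i : ℕ) : ℝ) ^ (-(1 / 4) : ℝ) *
          √((q - i)! : ℝ) * (p - 1) ^ (((q - i : ℕ) : ℝ) / 2))) := by ring
      _ ≤ |hermiteCoeff g q| * C * ((i + 1 : ℝ) ^ (1 / 4 : ℝ) *
          ((q : ℝ) ^ ((ℓ : ℝ) / 2 - 1 / 4) * √(q ! : ℝ) * (p - 1) ^ ((q : ℝ) / 2))) :=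
          mul_le_mul_of_nonneg_left
            (descFactorial_mul_sqrt_factorial_le hi hq (by linarith)) (by positivity)
      _ = _ := by ring
  set P : ℕ → Polynomial ℝ := fun q =>
    |hermiteCoeff g q| • (Polynomial.hermite q).map (Int.castRingHom ℝ)
  refine ⟨(∑' q, h q : Lp ℝ (ENNReal.ofReal p) stdGauss), isWeakDeriv_of_hasSum i (P := P) (fun q => ?_) (fun q => ?_)
    (hasSum_absHermite hg) hs.hasSum, Lp.memLp _⟩
  · filter_upwards [Lp.coeFn_smul |hermiteCoeff g q| (hermiteL2 q),
      (memLp_hermiteFun q).coeFn_toLp] with x hx hx'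
    rw [hx, Pi.smul_apply, hermiteL2, hx', hermiteFun_eq]
    simp [P]
  · have hd : Polynomial.derivative^[i] (P q) = (|hermiteCoeff g q| * q.descFactorial i) •
        (Polynomial.hermite (q - i)).map (Int.castRingHom ℝ) := by
      simp only [P]
      rw [Polynomial.iterate_derivative_smul, Polynomial.iterate_derivative_map,
        iterate_derivative_hermite, mul_smul]
      congr 1
      rw [zsmul_eq_mul, Polynomial.map_mul, Polynomial.smul_eq_C_mul]
      simp
    filter_upwards [Lp.coeFn_smul (|hermiteCoeff g q| * q.descFactorial i) (E (q - i)),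
      (hmem (q - i)).coeFn_toLp] with x hx hx'
    rw [hx, Pi.smul_apply, hx', hermiteFun_eq, hd, Polynomial.eval_smul]

theorem lemma3p3 (ℓ M : ℕ) (hM : 3 ≤ M) (g : ℝ → ℝ) (hg : MemGaussianSobolev ℓ 2 g)
    (hsum : Summable fun q : ℕ =>
      |hermiteCoeff g q| * (q : ℝ) ^ ((ℓ : ℝ) / 2 - 1 / 4) * √(q ! : ℝ) *
        ((M : ℝ) - 1) ^ ((q : ℝ) / 2)) :
    MemGaussianSobolev ℓ (M : ℝ≥0∞) (absHermite g) := by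
  have hp : (2 : ℝ) < M := by exact_mod_cast (by omega : 2 < M)
  have key := fun (i : ℕ) (hi : i ≤ ℓ) => exists_isWeakDeriv_absHermite hi hp hg.1 hsum
  simp only [ENNReal.ofReal_natCast] at key
  refine ⟨?_, fun i _ hi => key i hi⟩
  -- A weak derivative of order zero is `A(g)` almost everywhere, so membership in `L^M(γ)`
  -- transfers to it.
  obtain ⟨h, hw, hh⟩ := key 0 (Nat.zero_le ℓ)
  exact hh.ae_eq ((gaussianReal_absolutelyContinuous 0 one_ne_zero).ae_eq hw.ae_eq.symm)
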